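/- **Setting.** Let $N$ be a finite set of players and let $c:2^N\to\mathbb R_{\ge 0}$ be normalized ($c(\emptyset)=0$) and monotone ($c(T)\le c(S)$ for $T\subseteq S$). $\Pi(S)$ is the set of orders (permutations) of $S\subseteq N$; $c_{|S}$ and $\pi_{|S}$ are restrictions to $S$; $S\sqsubseteq\pi$ means that $S$ is the set of the first $|S|$ players of $\pi$; $p(i,\pi)$ consists of $i$ and the players before $i$ in $\pi$; $\mathrm{MC}(i,c,S)=c(S)-c(S\setminus\{i\})$ for $i\in S$; and $\mathrm{SV}_i(c)=\frac1{|N|!}\sum_{\pi\in\Pi(N)}\mathrm{MC}(i,c,p(i,\pi))$. **Coordinate functions.** A coordinate function on $A\subseteq N$ is a map $f$ that restricts to a bijection $\Pi(S)\to\Pi(S)$ for every $S\subseteq A$ and satisfies $f(\pi_{|S})=f(\pi)_{|S}$ whenever $\pi\in\Pi(T)$, $T\subseteq A$, $S\sqsubseteq\pi$. Fix a coordinate function $\mathrm{cd}_0$ on $N$ and, for each $i\in N$, a coordinate function $\mathrm{cd}_i$ on $N\setminus\{i\}$; these do not depend on the cost function. **GSFS-CS.** Let $g$ be a 0-1 valued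 normalized monotone function on $2^S$. The marginal player of an order $\pi'$ of a set of players is the player $j$ with $\mathrm{MC}(j,g,p(j,\pi'))=1$, if there is one. The shuffle of $\pi\in\Pi(S)$ is built by inserting the players one by one, in the order $\pi$, into an initially empty image order $\pi'$. When $i$ arrives: 1. If $i$ can be inserted so that she becomes the marginal player, she is inserted at the earliest such position. 2. Otherwise, if $\pi'$ has no marginal player, $\pi'$ becomes $\mathrm{cd}_0(\pi_{|p(i,\pi)})$. 3. Otherwise let $j$ be the marginal player of $\pi'$ and let $L$ be the set of players that arrived after $j$, up to and including $i$. The players outside $L$ keep their relative order, and the players of $L$ are placed immediately before $j$, as one block, in the order $\mathrm{cd}_j(\pi_{|L})$. The GSFS-CS share of $i$ is $\phi_i(S,g,\pi)=\mathrm{MC}(i,g,p(i,\pi'))$, where $\pi'$ is the final image order. **Greedy-monotone decomposition and eGSFS-CS.** The decomposition $D(c)=\{(g_k,\mu_k)\}$ is computed as follows. While $c$ has a positive value, output $(g,\mu)$, where $g(T)=1$ if $c(T)>0$ and $g(T)=0$ otherwise, and $\mu$ is the least positive value of $c$; then replace $c$ by $c-\mu g$. After the arrival of $S\sqsubseteq\pi$,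 eGSFS-CS charges player $i\in S$ $$\bar\phi_i(S,c_{|S},\pi_{|S})=\sum_{(g_k,\mu_k)\in D(c_{|S})}\mu_k\,\phi_i(S,g_k,\pi_{|S}).$$ **Theorem.** For every finite $N$, every choice of coordinate functions as above and every normalized monotone $c$: * The functions $g_k$ in $D(c)$ are 0-1 valued, normalized and monotone, $\mu_k\ge 0$, and $c=\sum_k\mu_kg_k$. * eGSFS-CS is an online cost sharing mechanism: for all $\pi\in\Pi(N)$ and $S\sqsubseteq\pi$, the shares $\bar\phi_i(S,c_{|S},\pi_{|S})$, $i\in S$, are nonnegative and sum to $c(S)$. * (SF) $\frac1{|N|!}\sum_{\pi\in\Pi(N)}\bar\phi_i(N,c,\pi)=\mathrm{SV}_i(c)$ for all $i\in N$. * (OIR) For all $\pi\in\Pi(N)$, all $T,S\sqsubseteq\pi$ with $T\subseteq S$, and all $i\in T$, $\bar\phi_i(S,c_{|S},\pi_{|S})\le\bar\phi_i(T,c_{|T},\pi_{|T})$. * (I4EA) For all $i\in N$ and $\pi_1,\pi_2\in\Pi(N)$ with $\pi_{1|N\setminus\{i\}}=\pi_{2|N\setminus\{i\}}$ and $p(i,\pi_1)\subset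 p(i,\pi_2)$, $\bar\phi_i(N,c,\pi_1)\le\bar\phi_i(N,c,\pi_2)$. -/

import Mathlib

/-- `orderings S` is the set `Π(S)` of all permutations of `S`: an arrival order of the players in
`S` is a list without repetitions whose entries are exactly the elements of `S`. -/
noncomputable def orderings {N : Type*} [DecidableEq N] (S : Finset N) : Finset (List N) :=
  S.toList.permutations.toFinset

theorem mem_orderings {N : Type*} [DecidableEq N] (S : Finset N) (l : List N) :
    l ∈ orderings S ↔ l.Nodup ∧ l.toFinset = S := by
  rw [orderings, List.mem_toFinset, List.mem_permutations]
  constructor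
  · intro h
    exact ⟨h.nodup_iff.mpr S.nodup_toList, by rw [List.toFinset_eq_of_perm _ _ h, S.toList_toFinset]⟩
  · rintro ⟨hn, rfl⟩
    exact (List.toFinset_toList hn).symm

/-- `c` is normalized. -/
def Normalized {N : Type*} (c : Finset N → ℝ) : Prop := c ∅ = 0

/-- `c` is monotone. -/
def MonotoneCost {N : Type*} (c : Finset N → ℝ) : Prop := ∀ T S : Finset N, T ⊆ S → c T ≤ c S

/-- The restriction `c_{|S}`. A set function on `2^S` is represented by the function on `2^N` that
evaluates it at the trace on `S`, so `restrictCost c S` carries the values of `c` on subsets of `S`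
and nothing else. -/
def restrictCost {N : Type*} [DecidableEq N] (c : Finset N → ℝ) (S : Finset N) : Finset N → ℝ :=
  fun T => c (T ∩ S)

/-- The restriction `π_{|S}`: the players in `S`, in the same relative order. -/
def restrictOrder {N : Type*} [DecidableEq N] (π : List N) (S : Finset N) : List N :=
  π.filter (fun x => x ∈ S)

/-- `S ⊑ π`: `S` is the set of the first `|S|` players of `π`. -/
def PrefixSet {N : Type*} [DecidableEq N] (S : Finset N) (π : List N) : Prop :=
  (π.take S.card).toFinset = S

/-- `p(i, π)`: the players strictly before `i` in `π`, together with `i`. -/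
def upTo {N : Type*} [DecidableEq N] (i : N) (π : List N) : Finset N :=
  insert i (π.takeWhile (fun x => x ≠ i)).toFinset

/-- Marginal cost of `i` to the coalition `S ∋ i`. -/
def MC {N : Type*} [DecidableEq N] (i : N) (c : Finset N → ℝ) (S : Finset N) : ℝ :=
  c S - c (S.erase i)

/-- Shapley value. -/
noncomputable def SV {N : Type*} [Fintype N] [DecidableEq N] (c : Finset N → ℝ) (i : N) : ℝ :=
  (1 / ((Fintype.card N).factorial : ℝ)) *
    ∑ π ∈ orderings (Finset.univ : Finset N), MC i c (upTo i π)

/-- A rule assigning a share `φ c π i` to each player `i` of the game with cost function `c` and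
arrival order `π`; the player set of the game is the set of entries of `π`. -/
abbrev Policy (N : Type*) := (Finset N → ℝ) → List N → N → ℝ

/-- At each stage of every game with cost function `c`, the shares computed from the local game
`(S, c_{|S}, π_{|S})` are nonnegative and add up to the cost of the players present. -/
def IsCostSharing {N : Type*} [Fintype N] [DecidableEq N] (φ : Policy N) (c : Finset N → ℝ) :
    Prop :=
  ∀ π ∈ orderings (Finset.univ : Finset N), ∀ S : Finset N, PrefixSet S π →
    (∀ i ∈ S, 0 ≤ φ (restrictCost c S) (restrictOrder π S) i) ∧
    ∑ i ∈ S, φ (restrictCost c S) (restrictOrder π S) i = c S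

/-- Online individual rationality. -/
def OIR {N : Type*} [Fintype N] [DecidableEq N] (φ : Policy N) (c : Finset N → ℝ) : Prop :=
  ∀ π ∈ orderings (Finset.univ : Finset N), ∀ T S : Finset N,
    PrefixSet T π → PrefixSet S π → T ⊆ S → ∀ i ∈ T,
      φ (restrictCost c S) (restrictOrder π S) i ≤ φ (restrictCost c T) (restrictOrder π T) i

/-- Incentives for early arrival. -/
def I4EA {N : Type*} [Fintype N] [DecidableEq N] (φ : Policy N) (c : Finset N → ℝ) : Prop :=
  ∀ i : N, ∀ π₁ ∈ orderings (Finset.univ : Finset N), ∀ π₂ ∈ orderings (Finset.univ : Finset N),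
    restrictOrder π₁ (Finset.univ.erase i) = restrictOrder π₂ (Finset.univ.erase i) →
    upTo i π₁ ⊂ upTo i π₂ → φ c π₁ i ≤ φ c π₂ i

/-- Shapley-fairness. -/
def ShapleyFair {N : Type*} [Fintype N] [DecidableEq N] (φ : Policy N) (c : Finset N → ℝ) :
    Prop :=
  ∀ i : N, (1 / ((Fintype.card N).factorial : ℝ)) *
    ∑ π ∈ orderings (Finset.univ : Finset N), φ c π i = SV c i

/-- `f` is a coordinate function on the player set `A`: a bijective rearrangement of the orders of
each subset of `A` that commutes with restriction to prefixes. -/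
structure IsCoordinateFunction {N : Type*} [DecidableEq N] (A : Finset N)
    (f : List N → List N) : Prop where
  bijOn : ∀ S ⊆ A, Set.BijOn f (orderings S : Set (List N)) (orderings S : Set (List N))
  restrict : ∀ T ⊆ A, ∀ π ∈ orderings T, ∀ S : Finset N, PrefixSet S π →
    f (restrictOrder π S) = restrictOrder (f π) S

/-- Inserting `i` into the image order `img` after its first `k` players makes `i` marginal. -/
def MarginalAt {N : Type*} [DecidableEq N] (g : Finset N → ℝ) (img : List N) (i : N) (k : ℕ) :
    Prop :=
  k ≤ img.length ∧ MC i g (insert i (img.take k).toFinset) = 1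

open scoped Classical in
/-- The marginal player of the order `img`, if there is one. -/
noncomputable def marginalPlayer {N : Type*} [DecidableEq N] (g : Finset N → ℝ) (img : List N) :
    Option N :=
  img.find? (fun j => decide (MC j g (upTo j img) = 1))

/-- The players arriving after `j` in `ρ`, in their order of arrival. -/
def lateArrivals {N : Type*} [DecidableEq N] (ρ : List N) (j : N) : List N :=
  (ρ.dropWhile (fun x => x ≠ j)).tail

/-- Arrangement of the image order `img` when a newcomer `i`, who arrives after the players `ρ`,
joins the late arriving set of the marginal player `j`: this set stands immediately before `j`
(after the related player of `j`, if any), in the order given by the coordinate function `f`;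
everybody else stays in place. -/
def insertLate {N : Type*} [DecidableEq N] (f : List N → List N) (ρ img : List N) (i j : N) :
    List N :=
  let others := img.filter (fun x => x ∉ lateArrivals ρ j)
  others.takeWhile (fun x => x ≠ j) ++ f (lateArrivals ρ j ++ [i]) ++
    others.dropWhile (fun x => x ≠ j)

open scoped Classical in
/-- One step of the generalized Shapley-fair shuffle: `ρ` is the arrival order so far, `img` its
image, `i` the newcomer. -/
noncomputable def gsfsStep {N : Type*} [DecidableEq N] (cd₀ : List N → List N)
    (cd : N → List N → List N) (g : Finset N → ℝ) (ρ img : List N) (i : N) : List N :=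
  if h : ∃ k, MarginalAt g img i k then
    img.take (Nat.find h) ++ i :: img.drop (Nat.find h)
  else
    match marginalPlayer g img with
    | none => cd₀ (ρ ++ [i])
    | some j => insertLate (cd j) ρ img i j

/-- The iteration of `gsfsStep`, with the arrival order read from its last player. -/
noncomputable def gsfsShufRev {N : Type*} [DecidableEq N] (cd₀ : List N → List N)
    (cd : N → List N → List N) (g : Finset N → ℝ) : List N → List N
  | [] => []
  | i :: r => gsfsStep cd₀ cd g r.reverse (gsfsShufRev cd₀ cd g r) i

/-- The generalized Shapley-fair shuffle of the arrival order `π`. -/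
noncomputable def gsfsShuf {N : Type*} [DecidableEq N] (cd₀ : List N → List N)
    (cd : N → List N → List N) (g : Finset N → ℝ) (π : List N) : List N :=
  gsfsShufRev cd₀ cd g π.reverse

/-- GSFS-CS: every player pays her marginal cost in the shuffled order. -/
noncomputable def gsfsCS {N : Type*} [DecidableEq N] (cd₀ : List N → List N)
    (cd : N → List N → List N) : Policy N :=
  fun g π i => MC i g (upTo i (gsfsShuf cd₀ cd g π))

open scoped Classical in
/-- The coalitions with positive cost. -/
noncomputable def posSupport {N : Type*} [Fintype N] (c : Finset N → ℝ) : Finset (Finset N) :=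
  Finset.univ.filter (fun T => 0 < c T)

open scoped Classical in
/-- The 0-1 function indicating the coalitions with positive cost. -/
noncomputable def gmIndicator {N : Type*} (c : Finset N → ℝ) : Finset N → ℝ :=
  fun T => if 0 < c T then 1 else 0

/-- The least positive cost of a coalition. -/
noncomputable def gmWeight {N : Type*} [Fintype N] (c : Finset N → ℝ)
    (h : (posSupport c).Nonempty) : ℝ :=
  (posSupport c).inf' h c

/-- The cost function that is left after one greedy step. -/
noncomputable def gmResidual {N : Type*} [Fintype N] (c : Finset N → ℝ)
    (h : (posSupport c).Nonempty) : Finset N → ℝ :=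
  fun T => c T - gmWeight c h * gmIndicator c T

theorem card_posSupport_gmResidual_lt {N : Type*} [Fintype N] (c : Finset N → ℝ)
    (h : (posSupport c).Nonempty) :
    (posSupport (gmResidual c h)).card < (posSupport c).card := by
  apply Finset.card_lt_card
  obtain ⟨T, hT, hTw⟩ := Finset.exists_mem_eq_inf' h c
  have hT0 : 0 < c T := by simpa [posSupport] using hT
  rw [Finset.ssubset_iff_of_subset]
  · refine ⟨T, hT, ?_⟩
    have hr : gmResidual c h T = 0 := by simp [gmResidual, gmIndicator, gmWeight, hT0, hTw]
    simp only [posSupport, Finset.mem_filter, Finset.mem_univ, true_and, hr, lt_irrefl,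
      not_false_eq_true]
  · intro S hS
    simp only [posSupport, Finset.mem_filter, Finset.mem_univ, true_and] at hS ⊢
    by_contra hc
    simp [gmResidual, gmIndicator, hc] at hS

open scoped Classical in
/-- Greedy-monotone decomposition: as long as some coalition has positive cost, split off the 0-1
function indicating these coalitions, with the largest weight that keeps the rest nonnegative, that
is, the least positive cost. The output is the list of the pairs `(g_k, μ_k)`. -/
noncomputable def gmDecomposition {N : Type*} [Fintype N] (c : Finset N → ℝ) :
    List ((Finset N → ℝ) × ℝ) :=
  if h : (posSupport c).Nonempty then
    (gmIndicator c, gmWeight c h) :: gmDecomposition (gmResidual c h)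
  else []
termination_by (posSupport c).card
decreasing_by exact card_posSupport_gmResidual_lt c h

/-- `D` lists pairs `(g_k, μ_k)` with `g_k` 0-1 valued, normalized and monotone, `μ_k ≥ 0`, and
`c = ∑ μ_k g_k`. -/
def IsZeroOneDecomposition {N : Type*} (c : Finset N → ℝ) (D : List ((Finset N → ℝ) × ℝ)) :
    Prop :=
  (∀ d ∈ D, (∀ T, d.1 T = 0 ∨ d.1 T = 1) ∧ Normalized d.1 ∧ MonotoneCost d.1 ∧ 0 ≤ d.2) ∧
  ∀ T : Finset N, c T = (D.map (fun d => d.2 * d.1 T)).sum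

/-- eGSFS-CS: the weighted sum of the GSFS-CS shares in the components of the cost function. -/
noncomputable def egsfsCS {N : Type*} [Fintype N] [DecidableEq N] (cd₀ : List N → List N)
    (cd : N → List N → List N) : Policy N :=
  fun c π i => ((gmDecomposition c).map (fun d => d.2 * gsfsCS cd₀ cd d.1 π i)).sum

/-! For a simple game everything rests on the shape of the image order. Either no coalition of
arrived players has value 1 and the image is `cd₀ π`, or `π = ρ ++ j :: l` and the image of `ρ` has
been opened at the earliest position where `j` makes the value 1, with `cd j l` and then `j` placed
there (`gsfsShuf_hasShape`). Two consequences follow.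

The shape can be decoded: the image determines its marginal split, hence `j`, the position, the
image of `ρ` and `cd j l`. So the shuffle is injective (`gsfsShuf_inj`), permutes the arrival
orders, and averages to the Shapley value.

The share of `i` has a closed criterion (`gsfsCS_eq_one_iff`): she pays 1 exactly when some prefix
of her predecessors' image has value 1 together with her, but value 0 together with all later
arrivals. Fewer later arrivals make this easier, which gives OIR. If she arrives later, the prefix
lifts to the larger image, since newcomers never reorder earlier players
(`restrictOrder_gsfsShuf_append`); this gives I4EA.

For general `c`, efficiency and Shapley-fairness follow by linearity over the components. OIR
compares decompositions of two different restrictions, whose components and weights need not match.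
A greedy sum is therefore rewritten as an integral over `t > 0` of the level games `c > t`
(`sum_gmDecomposition_eq_integral`). Level games commute with restriction, so shares can be compared
pointwise in `t` (`egsfsCS_le`). -/

/-- `g` is 0-1 valued, normalized and monotone. -/
structure IsSimpleGame {N : Type*} (g : Finset N → ℝ) : Prop where
  zero_or_one : ∀ T, g T = 0 ∨ g T = 1
  normalized : Normalized g
  mono : MonotoneCost g

namespace IsSimpleGame

variable {N : Type*} {g : Finset N → ℝ}

theorem eq_zero_of_subset (hg : IsSimpleGame g) {T S : Finset N} (h : T ⊆ S) (hS : g S = 0) :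
    g T = 0 := by
  have := hg.mono T S h
  rcases hg.zero_or_one T with h | h <;> linarith

theorem eq_one_of_subset (hg : IsSimpleGame g) {T S : Finset N} (h : T ⊆ S) (hT : g T = 1) :
    g S = 1 := by
  have := hg.mono T S h
  rcases hg.zero_or_one S with h | h <;> linarith

end IsSimpleGame

/-! ### Marginal players of an order, and coordinate functions on lists -/

section Orders

theorem notMem_of_nodup_append_cons {N : Type*} {A B : List N} {j : N} (h : (A ++ j :: B).Nodup) :
    j ∉ A ∧ j ∉ B := by
  simpa using (List.nodup_cons.1 (List.nodup_middle.1 h)).1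

variable {N : Type*} [DecidableEq N] {g : Finset N → ℝ}

theorem MC_insert (g : Finset N → ℝ) {i : N} {X : Finset N} (hi : i ∉ X) :
    MC i g (insert i X) = g (insert i X) - g X := by
  rw [MC, Finset.erase_insert hi]

theorem IsSimpleGame.MC_insert_eq_one_iff (hg : IsSimpleGame g) {i : N} {X : Finset N}
    (hi : i ∉ X) : MC i g (insert i X) = 1 ↔ g (insert i X) = 1 ∧ g X = 0 := by
  rw [MC_insert g hi]
  rcases hg.zero_or_one X with h | h <;> rcases hg.zero_or_one (insert i X) with h' | h' <;>
    norm_num [h, h']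

theorem toFinset_take_subset (l : List N) {m k : ℕ} (h : m ≤ k) :
    (l.take m).toFinset ⊆ (l.take k).toFinset := fun _ hx =>
  List.mem_toFinset.2 (List.take_subset_take_left _ h (List.mem_toFinset.1 hx))

theorem upTo_subset {i : N} {l : List N} (hi : i ∈ l) : upTo i l ⊆ l.toFinset := fun z hz => by
  rw [upTo, Finset.mem_insert, List.mem_toFinset] at hz
  rw [List.mem_toFinset]
  rcases hz with rfl | hz
  · exact hi
  · exact (List.takeWhile_sublist _).subset hz

theorem upTo_append_cons {A : List N} {i : N} (hi : i ∉ A) (B : List N) :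
    upTo i (A ++ i :: B) = insert i A.toFinset := by
  rw [upTo, List.takeWhile_append_of_pos]
  · simp
  · intro a ha
    simpa using fun h : a = i => hi (h ▸ ha)

/-- The marginal costs telescope along the order. -/
theorem sum_MC_upTo (c : Finset N → ℝ) {l : List N} (hn : l.Nodup) :
    ∑ i ∈ l.toFinset, MC i c (upTo i l) = c l.toFinset - c ∅ := by
  induction l using List.reverseRecOn with
  | nil => simp
  | append_singleton l x ih =>
    have hl := (List.nodup_append.1 hn).1
    have hx : x ∉ l := (notMem_of_nodup_append_cons hn).1
    have hins : (l ++ [x]).toFinset = insert x l.toFinset := by ext; simp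
    have hx' : x ∉ l.toFinset := by simpa
    rw [hins, Finset.sum_insert hx', upTo_append_cons hx, MC_insert c hx',
      Finset.sum_congr rfl (g := fun i => MC i c (upTo i l)), ih hl]
    · ring
    · intro i hi
      obtain ⟨A, B, rfl⟩ := List.append_of_mem (List.mem_toFinset.1 hi)
      have hiA := (notMem_of_nodup_append_cons hl).1
      rw [List.append_assoc, List.cons_append, upTo_append_cons hiA, upTo_append_cons hiA]

theorem IsSimpleGame.MC_upTo_eq_one_iff (hg : IsSimpleGame g) {A : List N} {i : N} (hi : i ∉ A)
    (B : List N) : MC i g (upTo i (A ++ i :: B)) = 1 ↔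
      g (insert i A.toFinset) = 1 ∧ g A.toFinset = 0 := by
  rw [upTo_append_cons hi, hg.MC_insert_eq_one_iff (by simpa using hi)]

theorem IsSimpleGame.MC_zero_or_one (hg : IsSimpleGame g) (i : N) (S : Finset N) :
    MC i g S = 0 ∨ MC i g S = 1 := by
  have := hg.mono _ _ (S.erase_subset i)
  rw [MC]
  rcases hg.zero_or_one (S.erase i) with h | h <;> rcases hg.zero_or_one S with h' | h' <;>
    first | (left; linarith) | (right; linarith)

theorem IsSimpleGame.marginalAt_iff (hg : IsSimpleGame g) {img : List N} {i : N} (hi : i ∉ img)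
    (k : ℕ) : MarginalAt g img i k ↔ k ≤ img.length ∧
      g (insert i (img.take k).toFinset) = 1 ∧ g (img.take k).toFinset = 0 := by
  rw [MarginalAt, hg.MC_insert_eq_one_iff]
  simpa using fun h => hi (List.mem_of_mem_take h)

/-- An order has at most one marginal player. -/
theorem IsSimpleGame.marginal_split_unique (hg : IsSimpleGame g) {A B A' B' : List N} {i j : N}
    (h : A ++ i :: B = A' ++ j :: B')
    (hA : g A.toFinset = 0) (hi : g (insert i A.toFinset) = 1)
    (hA' : g A'.toFinset = 0) (hj : g (insert j A'.toFinset) = 1) :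
    A = A' ∧ i = j ∧ B = B' := by
  rcases List.append_eq_append_iff.1 h with ⟨l, h1, h2⟩ | ⟨l, h1, h2⟩
  · cases l with
    | nil => simp_all
    | cons a l =>
      exfalso
      obtain ⟨rfl, -⟩ := by simpa using h2
      have := hg.eq_one_of_subset (S := A'.toFinset) (by rw [h1]; intro x; simp; tauto) hi
      linarith
  · cases l with
    | nil => simp_all
    | cons a l =>
      exfalso
      obtain ⟨rfl, -⟩ := by simpa using h2
      have := hg.eq_one_of_subset (S := A.toFinset) (by rw [h1]; intro x; simp; tauto) hj
      linarith

theorem IsSimpleGame.marginalPlayer_append_cons (hg : IsSimpleGame g) {A B : List N} {j : N}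
    (hn : (A ++ j :: B).Nodup) (hA : g A.toFinset = 0) (hj : g (insert j A.toFinset) = 1) :
    marginalPlayer g (A ++ j :: B) = some j := by
  rw [marginalPlayer, List.find?_eq_some_iff_append]
  have hjA : j ∉ A := (notMem_of_nodup_append_cons hn).1
  refine ⟨by simpa using (hg.MC_upTo_eq_one_iff hjA B).2 ⟨hj, hA⟩, A, B, rfl, fun a ha => ?_⟩
  obtain ⟨A₁, A₂, rfl⟩ := List.append_of_mem ha
  have haA : a ∉ A₁ := (notMem_of_nodup_append_cons (List.nodup_append.1 hn).1).1
  have h0 := hg.eq_zero_of_subset (T := insert a A₁.toFinset) (by intro x; simp; tauto) hA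
  rw [List.append_assoc, List.cons_append]
  simp [hg.MC_upTo_eq_one_iff haA, h0]

theorem IsSimpleGame.marginalPlayer_eq_none (hg : IsSimpleGame g) {l : List N}
    (hl : g l.toFinset = 0) : marginalPlayer g l = none := by
  rw [marginalPlayer, List.find?_eq_none]
  intro a ha
  have h0 : g (upTo a l) = 0 := hg.eq_zero_of_subset (upTo_subset ha) hl
  have h1 : g ((upTo a l).erase a) = 0 := hg.eq_zero_of_subset (Finset.erase_subset _ _) h0
  simp [MC, h0, h1]

theorem mem_orderings_iff_perm {l m : List N} (hl : l.Nodup) :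
    m ∈ orderings l.toFinset ↔ m.Perm l := by
  rw [mem_orderings]
  exact ⟨fun h => List.perm_of_nodup_nodup_toFinset_eq h.1 hl h.2,
    fun h => ⟨h.nodup_iff.2 hl, List.toFinset_eq_of_perm _ _ h⟩⟩

theorem restrictOrder_append_of_disjoint {l m : List N} (h : (l ++ m).Nodup) :
    restrictOrder (l ++ m) l.toFinset = l := by
  rw [restrictOrder, List.filter_append, List.filter_eq_self.2 (by simp),
    List.filter_eq_nil_iff.2, List.append_nil]
  intro a ha
  simpa using fun h' => (List.nodup_append.1 h).2.2 a h' a ha rfl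

theorem prefixSet_append {l m : List N} (h : l.Nodup) : PrefixSet l.toFinset (l ++ m) := by
  rw [PrefixSet, List.toFinset_card_of_nodup h, List.take_left]

namespace IsCoordinateFunction

variable {A : Finset N} {f : List N → List N}

theorem perm (hf : IsCoordinateFunction A f) {l : List N} (hl : l.Nodup) (hA : l.toFinset ⊆ A) :
    (f l).Perm l :=
  (mem_orderings_iff_perm hl).1 ((hf.bijOn _ hA).mapsTo ((mem_orderings_iff_perm hl).2 .rfl))

theorem perm_of_notMem [Fintype N] {i : N} (hf : IsCoordinateFunction (Finset.univ.erase i) f)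
    {l : List N} (hl : l.Nodup) (hi : i ∉ l) : (f l).Perm l :=
  hf.perm hl fun x hx => by
    simpa using fun h : x = i => hi (h ▸ List.mem_toFinset.1 hx)

theorem nil (hf : IsCoordinateFunction A f) : f [] = [] :=
  (hf.perm List.nodup_nil (by simp)).eq_nil

theorem inj (hf : IsCoordinateFunction A f) {l m : List N} (hl : l.Nodup) (hm : m.Perm l)
    (hA : l.toFinset ⊆ A) (h : f l = f m) : l = m :=
  (hf.bijOn _ hA).injOn ((mem_orderings_iff_perm hl).2 .rfl) ((mem_orderings_iff_perm hl).2 hm) h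

theorem restrict_append (hf : IsCoordinateFunction A f) {l m : List N} (h : (l ++ m).Nodup)
    (hA : (l ++ m).toFinset ⊆ A) : restrictOrder (f (l ++ m)) l.toFinset = f l := by
  rw [← hf.restrict _ hA _ ((mem_orderings_iff_perm h).2 .rfl) _
    (prefixSet_append (List.nodup_append.1 h).1), restrictOrder_append_of_disjoint h]

end IsCoordinateFunction

end Orders

/-! ### The shape of the image order in a simple game -/

section Shuffle

variable {N : Type*} [DecidableEq N] {cd₀ : List N → List N}
  {cd : N → List N → List N} {g : Finset N → ℝ}

theorem gsfsShuf_append_singleton (π : List N) (x : N) :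
    gsfsShuf cd₀ cd g (π ++ [x]) = gsfsStep cd₀ cd g π (gsfsShuf cd₀ cd g π) x := by
  simp [gsfsShuf, gsfsShufRev]

theorem lateArrivals_append_cons {ρ : List N} {j : N} (hj : j ∉ ρ) (l : List N) :
    lateArrivals (ρ ++ j :: l) j = l := by
  rw [lateArrivals, List.dropWhile_append_of_pos]
  · simp
  · intro a ha
    simpa using fun h : a = j => hj (h ▸ ha)

/-- `k` is the earliest position of `τ` in which `j` becomes the marginal player, and `j` stays
marginal when the players `l` are placed immediately before her. -/
structure IsPivot (g : Finset N → ℝ) (τ : List N) (j : N) (l : List N) (k : ℕ) : Prop where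
  le_length : k ≤ τ.length
  eq_zero_of_lt : ∀ m < k, g (insert j (τ.take m).toFinset) = 0
  eq_one : g (insert j (τ.take k).toFinset) = 1
  eq_zero : g ((τ.take k) ++ l).toFinset = 0

/-- The order `τ` with `j` inserted after the first `k` players and the block `b` immediately
before `j`. -/
def insertBlock (τ : List N) (k : ℕ) (b : List N) (j : N) : List N :=
  (τ.take k ++ b) ++ j :: τ.drop k

/-- Deleting the late arrivals removes exactly the old block, so the new block takes its place and
the order `b` of the old one is forgotten. -/
theorem insertLate_insertBlock {f : List N → List N} {ρ τ l b : List N} {i j : N} (k : ℕ)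
    (hn : (ρ ++ j :: l).Nodup) (hτ : τ.Perm ρ) (hb : b.Perm l) :
    insertLate f (ρ ++ j :: l) (insertBlock τ k b j) i j = insertBlock τ k (f (l ++ [i])) j := by
  obtain ⟨hjρ, hjl⟩ := notMem_of_nodup_append_cons hn
  have hτl : ∀ a ∈ τ, a ∉ l := fun a ha h =>
    (List.nodup_append.1 hn).2.2 a (hτ.subset ha) a (by simp [h]) rfl
  have hτj : ∀ a ∈ τ, a ≠ j := fun a ha h => hjρ (h ▸ hτ.subset ha)
  have hfil : (insertBlock τ k b j).filter (fun x => x ∉ l) = τ.take k ++ j :: τ.drop k := by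
    rw [insertBlock, List.filter_append, List.filter_append, List.filter_cons_of_pos (by simpa),
      List.filter_eq_self.2 fun a ha => by simpa using hτl a (List.mem_of_mem_take ha),
      List.filter_eq_nil_iff.2 fun a ha => by simpa using hb.subset ha,
      List.filter_eq_self.2 fun a ha => by simpa using hτl a (List.mem_of_mem_drop ha),
      List.append_nil]
  have hpos : ∀ a ∈ τ.take k, (decide (a ≠ j)) = true := fun a ha => by
    simpa using hτj a (List.mem_of_mem_take ha)
  rw [insertLate, lateArrivals_append_cons hjρ]
  simp only [hfil]
  rw [List.takeWhile_append_of_pos hpos, List.dropWhile_append_of_pos hpos]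
  simp [insertBlock]

theorem IsPivot.eq_zero_of_perm {τ l b : List N} {j : N} {k : ℕ} (h : IsPivot g τ j l k)
    (hb : b.Perm l) : g (τ.take k ++ b).toFinset = 0 := by
  rw [← h.eq_zero, List.toFinset_append, List.toFinset_append, List.toFinset_eq_of_perm _ _ hb]

theorem IsPivot.eq_one_append {τ l : List N} {j : N} {k : ℕ} (h : IsPivot g τ j l k)
    (hg : IsSimpleGame g) (b : List N) : g (insert j (τ.take k ++ b).toFinset) = 1 :=
  hg.eq_one_of_subset (by intro y; simp; tauto) h.eq_one

/-- This is why the earliest position is chosen. If `k < k'`, both orders have the same first `k`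
players; with `j` these have value 1 by the first pivot and value 0 by minimality of `k'`. -/
theorem IsPivot.position_unique {τ τ' l l' b b' : List N} {j : N} {k k' : ℕ}
    (h : IsPivot g τ j l k) (h' : IsPivot g τ' j l' k')
    (he : τ.take k ++ b = τ'.take k' ++ b') : k = k' := by
  wlog hlt : k < k' generalizing τ τ' l l' b b' k k'
  · rcases Nat.lt_or_ge k' k with hgt | hge
    · exact (this h' h he.symm hgt).symm
    · omega
  exfalso
  have h0 := h'.eq_zero_of_lt k hlt
  have h2 := congrArg (List.take k) he
  rw [List.take_append_of_le_length (by simp [h.le_length]),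
    List.take_append_of_le_length (by simp [hlt.le, hlt.le.trans h'.le_length]), List.take_take,
    List.take_take, min_self, min_eq_left hlt.le] at h2
  rw [← h2, h.eq_one] at h0
  norm_num at h0

theorem IsSimpleGame.gsfsCS_le_of_imp (hg : IsSimpleGame g) {π₁ π₂ : List N} {i : N}
    (h : gsfsCS cd₀ cd g π₁ i = 1 → gsfsCS cd₀ cd g π₂ i = 1) :
    gsfsCS cd₀ cd g π₁ i ≤ gsfsCS cd₀ cd g π₂ i := by
  rcases hg.MC_zero_or_one i (upTo i (gsfsShuf cd₀ cd g π₁)) with h1 | h1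
  · rw [gsfsCS, gsfsCS, h1]
    rcases hg.MC_zero_or_one i (upTo i (gsfsShuf cd₀ cd g π₂)) with h2 | h2 <;> norm_num [h2]
  · exact (h1.trans (h h1).symm).le

variable [Fintype N]

theorem insertLate_perm (hcd : ∀ i : N, IsCoordinateFunction (Finset.univ.erase i) (cd i))
    {ρ img : List N} {i j : N} (hn : (ρ ++ [i]).Nodup) (hp : img.Perm ρ) (hj : j ∈ ρ) :
    (insertLate (cd j) ρ img i j).Perm (ρ ++ [i]) := by
  obtain ⟨ρ, l, rfl⟩ := List.append_of_mem hj
  have hn' : (ρ ++ j :: (l ++ [i])).Nodup := by simpa using hn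
  obtain ⟨hjρ, hjl⟩ := notMem_of_nodup_append_cons hn'
  have hl : (l ++ [i]).Nodup := hn.sublist (by simp)
  have hcp : (cd j (l ++ [i])).Perm (l ++ [i]) := (hcd j).perm_of_notMem hl hjl
  have hfil : (img.filter (fun x => x ∉ l)).Perm (ρ ++ [j]) := by
    refine (hp.filter _).trans (List.Perm.of_eq ?_)
    rw [List.filter_append, List.filter_cons_of_pos (by simpa using fun h => hjl (by simp [h])),
      List.filter_eq_self.2, List.filter_eq_nil_iff.2]
    · simp
    · intro a ha
      simp only [List.nodup_append] at hn
      simpa using fun h => hn.1.2.2 a ha a (by simp [h]) rfl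
  rw [insertLate, lateArrivals_append_cons hjρ]
  set o := img.filter (fun x => x ∉ l)
  calc
    List.Perm _ (cd j (l ++ [i]) ++ (o.takeWhile (fun x => x ≠ j) ++ o.dropWhile (fun x => x ≠ j)))
      := by
        rw [← List.append_assoc]
        exact List.perm_append_comm.append_right _
    List.Perm _ ((l ++ [i]) ++ (ρ ++ [j])) := by
        rw [List.takeWhile_append_dropWhile]
        exact hcp.append hfil
    List.Perm _ _ := List.perm_append_comm.trans (by simp)

theorem gsfsStep_perm (hcd₀ : IsCoordinateFunction Finset.univ cd₀)
    (hcd : ∀ i : N, IsCoordinateFunction (Finset.univ.erase i) (cd i))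
    {ρ img : List N} {i : N} (hn : (ρ ++ [i]).Nodup) (hp : img.Perm ρ) :
    (gsfsStep cd₀ cd g ρ img i).Perm (ρ ++ [i]) := by
  unfold gsfsStep
  split_ifs with h
  · refine List.perm_middle.trans ?_
    rw [List.take_append_drop]
    exact (hp.cons i).trans (List.perm_append_singleton i ρ).symm
  · split
    · exact hcd₀.perm hn (Finset.subset_univ _)
    · next j hj =>
      exact insertLate_perm hcd hn hp (hp.subset (List.mem_of_find?_eq_some hj))

theorem gsfsShuf_perm (hcd₀ : IsCoordinateFunction Finset.univ cd₀)
    (hcd : ∀ i : N, IsCoordinateFunction (Finset.univ.erase i) (cd i))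
    {π : List N} (hn : π.Nodup) : (gsfsShuf cd₀ cd g π).Perm π := by
  induction π using List.reverseRecOn with
  | nil => exact .rfl
  | append_singleton π x ih =>
    rw [gsfsShuf_append_singleton]
    exact gsfsStep_perm hcd₀ hcd hn (ih (List.nodup_append.1 hn).1)

/-- The form of the image order: no coalition of the players in `π` has positive cost, or the image
order is the image order before the arrival of the marginal player `j`, with `j` and the block of
later arrivals inserted. -/
def HasShape (cd₀ : List N → List N) (cd : N → List N → List N) (g : Finset N → ℝ) (π : List N) :
    Prop :=
  (g π.toFinset = 0 ∧ gsfsShuf cd₀ cd g π = cd₀ π) ∨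
  ∃ ρ j l k, π = ρ ++ j :: l ∧ IsPivot g (gsfsShuf cd₀ cd g ρ) j l k ∧
    gsfsShuf cd₀ cd g π = insertBlock (gsfsShuf cd₀ cd g ρ) k (cd j l) j

/-- What the arrival of `x` does to an image order with marginal player `j`, or with none. -/
theorem gsfsShuf_append_singleton_cases (hg : IsSimpleGame g)
    (hcd₀ : IsCoordinateFunction Finset.univ cd₀)
    (hcd : ∀ i : N, IsCoordinateFunction (Finset.univ.erase i) (cd i))
    {π : List N} {x : N} (hn : (π ++ [x]).Nodup) (hs : HasShape cd₀ cd g π) :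
    (g (π ++ [x]).toFinset = 0 ∧ gsfsShuf cd₀ cd g π = cd₀ π ∧
      gsfsShuf cd₀ cd g (π ++ [x]) = cd₀ (π ++ [x])) ∨
    (∃ k, IsPivot g (gsfsShuf cd₀ cd g π) x [] k ∧
      gsfsShuf cd₀ cd g (π ++ [x]) = insertBlock (gsfsShuf cd₀ cd g π) k [] x) ∨
    (¬ ∃ k, MarginalAt g (gsfsShuf cd₀ cd g π) x k) ∧
    ∃ ρ j l k, π = ρ ++ j :: l ∧ IsPivot g (gsfsShuf cd₀ cd g ρ) j (l ++ [x]) k ∧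
      gsfsShuf cd₀ cd g π = insertBlock (gsfsShuf cd₀ cd g ρ) k (cd j l) j ∧
      gsfsShuf cd₀ cd g (π ++ [x]) =
        insertBlock (gsfsShuf cd₀ cd g ρ) k (cd j (l ++ [x])) j := by
  classical
  have hπ : π.Nodup := (List.nodup_append.1 hn).1
  have hp := gsfsShuf_perm (g := g) hcd₀ hcd hπ
  have hpf := List.toFinset_eq_of_perm _ _ hp
  have hxπ : x ∉ π := fun h => (List.nodup_append.1 hn).2.2 x h x (by simp) rfl
  have hx : x ∉ gsfsShuf cd₀ cd g π := fun h => hxπ (hp.subset h)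
  have hins : (π ++ [x]).toFinset = insert x π.toFinset := by ext; simp
  rw [gsfsShuf_append_singleton]
  by_cases hM : ∃ k, MarginalAt g (gsfsShuf cd₀ cd g π) x k
  · right; left
    have hk := (hg.marginalAt_iff hx _).1 (Nat.find_spec hM)
    refine ⟨Nat.find hM, ⟨hk.1, fun m hm => ?_, hk.2.1, by simpa using hk.2.2⟩, ?_⟩
    -- Otherwise `m` would be an earlier position in which `x` is marginal.
    · by_contra hne
      refine Nat.find_min hM hm ((hg.marginalAt_iff hx _).2 ⟨by omega, ?_, ?_⟩)
      · exact (hg.zero_or_one _).resolve_left hne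
      · exact hg.eq_zero_of_subset
          (toFinset_take_subset _ hm.le) hk.2.2
    · simp only [gsfsStep, dif_pos hM]
      simp [insertBlock]
  · rcases hs with ⟨h0, he⟩ | ⟨ρ, j, l, k, rfl, hpiv, he⟩
    · left
      have h0' : g (π ++ [x]).toFinset = 0 := by
        by_contra hne
        -- If the arrival of `x` raised the total value to 1, `x` would be marginal in the last
        -- position.
        refine hM ⟨(gsfsShuf cd₀ cd g π).length, (hg.marginalAt_iff hx _).2 ⟨le_rfl, ?_, ?_⟩⟩
        · rw [List.take_length, hpf, ← hins]
          exact (hg.zero_or_one _).resolve_left hne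
        · rw [List.take_length, hpf, h0]
      refine ⟨h0', he, ?_⟩
      simp only [gsfsStep, dif_neg hM]
      rw [hg.marginalPlayer_eq_none (by rw [hpf, h0])]
    · right; right
      refine ⟨hM, ρ, j, l, k, rfl, ?_, he, ?_⟩
      all_goals
        have hρ : ρ.Nodup := hπ.sublist (by simp)
        have hl : l.Nodup := hπ.sublist (by simp)
        have hjl : j ∉ l := (notMem_of_nodup_append_cons hπ).2
        have hτ := gsfsShuf_perm (g := g) hcd₀ hcd hρ
        have hb : (cd j l).Perm l := (hcd j).perm_of_notMem hl hjl
        set τ := gsfsShuf cd₀ cd g ρ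
      · refine ⟨hpiv.le_length, hpiv.eq_zero_of_lt, hpiv.eq_one, ?_⟩
        by_contra hne
        -- If adding `x` to the players before `j` gave value 1, `x` would be marginal immediately
        -- before `j`.
        refine hM ⟨(τ.take k ++ cd j l).length, (hg.marginalAt_iff hx _).2 ⟨?_, ?_, ?_⟩⟩
        · rw [he, insertBlock]; simp
        · rw [he, insertBlock, List.take_left, List.toFinset_append, List.toFinset_eq_of_perm _ _ hb]
          have := (hg.zero_or_one _).resolve_left hne
          rw [← this]
          congr 1
          ext; simp
        · rw [he, insertBlock, List.take_left, hpiv.eq_zero_of_perm hb]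
      · simp only [gsfsStep, dif_neg hM]
        have hmp : marginalPlayer g (gsfsShuf cd₀ cd g (ρ ++ j :: l)) = some j := by
          have hn' : (insertBlock τ k (cd j l) j).Nodup := he ▸ hp.nodup_iff.2 hπ
          rw [he]
          exact hg.marginalPlayer_append_cons hn' (hpiv.eq_zero_of_perm hb)
            (hpiv.eq_one_append hg _)
        rw [hmp]
        simp only [he]
        exact insertLate_insertBlock k hπ hτ hb

theorem gsfsShuf_hasShape (hg : IsSimpleGame g)
    (hcd₀ : IsCoordinateFunction Finset.univ cd₀)
    (hcd : ∀ i : N, IsCoordinateFunction (Finset.univ.erase i) (cd i))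
    {π : List N} (hn : π.Nodup) : HasShape cd₀ cd g π := by
  induction π using List.reverseRecOn with
  | nil => exact .inl ⟨hg.normalized, hcd₀.nil.symm⟩
  | append_singleton π x ih =>
    rcases gsfsShuf_append_singleton_cases hg hcd₀ hcd hn (ih (List.nodup_append.1 hn).1) with
      ⟨h, -, h'⟩ | ⟨k, h, h'⟩ | ⟨-, ρ, j, l, k, rfl, h, -, h'⟩
    · exact .inl ⟨h, h'⟩
    · exact .inr ⟨π, x, [], k, rfl, h, by rw [h', (hcd x).nil]⟩
    · exact .inr ⟨ρ, j, l ++ [x], k, by simp, h, h'⟩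

end Shuffle

/-! ### Stability of the image order, and when a player stays marginal -/

section SimpleGames

variable {N : Type*} [Fintype N] [DecidableEq N] {cd₀ : List N → List N}
  {cd : N → List N → List N} {g : Finset N → ℝ}

/-- A player who arrives after the players `π` leaves their relative order in the image as it was. -/
theorem restrictOrder_gsfsShuf_append_singleton (hg : IsSimpleGame g)
    (hcd₀ : IsCoordinateFunction Finset.univ cd₀)
    (hcd : ∀ i : N, IsCoordinateFunction (Finset.univ.erase i) (cd i))
    {π : List N} {x : N} (hn : (π ++ [x]).Nodup) :
    restrictOrder (gsfsShuf cd₀ cd g (π ++ [x])) π.toFinset = gsfsShuf cd₀ cd g π := by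
  have hπ : π.Nodup := (List.nodup_append.1 hn).1
  have hxπ : x ∉ π := fun h => (List.nodup_append.1 hn).2.2 x h x (by simp) rfl
  rcases gsfsShuf_append_singleton_cases hg hcd₀ hcd hn (gsfsShuf_hasShape hg hcd₀ hcd hπ) with
    ⟨-, h, h'⟩ | ⟨k, -, h'⟩ | ⟨-, ρ, j, l, k, rfl, -, h, h'⟩
  · rw [h, h', hcd₀.restrict_append hn (Finset.subset_univ _)]
  · have hp := gsfsShuf_perm (g := g) hcd₀ hcd hπ
    rw [h', insertBlock, restrictOrder, List.append_nil, List.filter_append,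
      List.filter_cons_of_neg (by simpa), ← List.filter_append, List.take_append_drop,
      List.filter_eq_self]
    simpa using fun a ha => hp.subset ha
  · have hτ := gsfsShuf_perm (g := g) hcd₀ hcd (hπ.sublist (by simp) : ρ.Nodup)
    have hn' : (ρ ++ j :: (l ++ [x])).Nodup := by simpa using hn
    have hl : (l ++ [x]).Nodup := hn'.sublist (by simp)
    have hjl := (notMem_of_nodup_append_cons hn').2
    have hb := (hcd j).perm_of_notMem hl hjl
    have hA : (l ++ [x]).toFinset ⊆ Finset.univ.erase j := fun y hy => by
      simpa using fun h : y = j => hjl (h ▸ List.mem_toFinset.1 hy)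
    rw [h, h', insertBlock, insertBlock, restrictOrder, List.filter_append, List.filter_append,
      List.filter_cons_of_pos (by simp)]
    congr 2
    · rw [List.filter_eq_self]
      intro a ha
      simp [hτ.subset (List.mem_of_mem_take ha)]
    -- On entries of the new block, membership in `ρ ++ j :: l` is the same as membership in `l`, so
    -- compatibility of `cd j` with prefixes applies.
    · rw [← (hcd j).restrict_append hl hA, restrictOrder]
      refine List.filter_congr fun a ha => ?_
      have ha' := hb.subset ha
      have h1 : a ∈ ρ → a ∉ l ++ [x] := fun h1 h2 =>
        (List.nodup_append.1 hn').2.2 a h1 a (List.mem_cons_of_mem _ h2) rfl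
      have h2 : a ≠ j := fun h => hjl (h ▸ ha')
      simp only [List.mem_toFinset, List.mem_append, List.mem_cons, decide_eq_decide]
      tauto
    · rw [List.filter_eq_self]
      intro a ha
      simp [hτ.subset (List.mem_of_mem_drop ha)]

theorem restrictOrder_gsfsShuf_append (hg : IsSimpleGame g)
    (hcd₀ : IsCoordinateFunction Finset.univ cd₀)
    (hcd : ∀ i : N, IsCoordinateFunction (Finset.univ.erase i) (cd i))
    {π l : List N} (hn : (π ++ l).Nodup) :
    restrictOrder (gsfsShuf cd₀ cd g (π ++ l)) π.toFinset = gsfsShuf cd₀ cd g π := by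
  induction l using List.reverseRecOn with
  | nil =>
    have hp := gsfsShuf_perm (g := g) hcd₀ hcd hn
    rw [List.append_nil] at hp ⊢
    rw [restrictOrder, List.filter_eq_self]
    simpa using fun a ha => hp.subset ha
  | append_singleton l x ih =>
    rw [← List.append_assoc] at hn ⊢
    rw [← ih (List.nodup_append.1 hn).1, ← restrictOrder_gsfsShuf_append_singleton hg hcd₀ hcd hn]
    simp only [restrictOrder, List.filter_filter]
    refine List.filter_congr fun a _ => ?_
    simp only [List.mem_toFinset, List.mem_append, ← Bool.decide_and, decide_eq_decide]
    tauto

/-- Uniqueness of the marginal split identifies `i` with the player `j` of the shape; then `ρ = α`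
and `l = γ`. -/
theorem exists_isPivot_of_marginal (hg : IsSimpleGame g)
    (hcd₀ : IsCoordinateFunction Finset.univ cd₀)
    (hcd : ∀ i : N, IsCoordinateFunction (Finset.univ.erase i) (cd i))
    {α γ : List N} {i : N} (hn : (α ++ i :: γ).Nodup)
    (h : MC i g (upTo i (gsfsShuf cd₀ cd g (α ++ i :: γ))) = 1) :
    ∃ k, IsPivot g (gsfsShuf cd₀ cd g α) i γ k := by
  have hp := gsfsShuf_perm (g := g) hcd₀ hcd hn
  obtain ⟨A, B, hAB⟩ := List.append_of_mem (hp.symm.subset (by simp : i ∈ α ++ i :: γ))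
  have hiA : i ∉ A := (notMem_of_nodup_append_cons (hAB ▸ hp.nodup_iff.2 hn)).1
  rw [hAB, hg.MC_upTo_eq_one_iff hiA] at h
  rcases gsfsShuf_hasShape hg hcd₀ hcd hn with ⟨h0, -⟩ | ⟨ρ, j, l, k, he, hpiv, hs⟩
  · have := hg.eq_one_of_subset (S := (A ++ i :: B).toFinset) (by intro y; simp; tauto) h.1
    rw [← hAB, List.toFinset_eq_of_perm _ _ hp, h0] at this
    norm_num at this
  · have hn' := he ▸ hn
    have hjl := notMem_of_nodup_append_cons hn'
    have hb := (hcd j).perm_of_notMem (hn'.sublist (by simp)) hjl.2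
    obtain ⟨-, rfl, -⟩ := hg.marginal_split_unique (hAB.symm.trans hs) h.2 h.1
      (hpiv.eq_zero_of_perm hb) (hpiv.eq_one_append hg _)
    obtain ⟨rfl, -, rfl⟩ := (List.append_cons_inj_of_notMem hjl.1 hjl.2).1 he.symm
    exact ⟨k, hpiv⟩

/-- The witness `k` need not be the earliest position; the pivot `m` found for `i` satisfies `m ≤
k`. Induction on the later arrivals shows that none of them can displace `i`: a displacing player
would give value 1 to a coalition inside the one that `h0` declares worthless. -/
theorem gsfsShuf_eq_insertBlock (hg : IsSimpleGame g)
    (hcd₀ : IsCoordinateFunction Finset.univ cd₀)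
    (hcd : ∀ i : N, IsCoordinateFunction (Finset.univ.erase i) (cd i))
    {α γ : List N} {i : N} (hn : (α ++ i :: γ).Nodup) {k : ℕ}
    (hk : k ≤ (gsfsShuf cd₀ cd g α).length)
    (h1 : g (insert i ((gsfsShuf cd₀ cd g α).take k).toFinset) = 1)
    (h0 : g ((gsfsShuf cd₀ cd g α).take k ++ γ).toFinset = 0) :
    ∃ m, IsPivot g (gsfsShuf cd₀ cd g α) i γ m ∧
      gsfsShuf cd₀ cd g (α ++ i :: γ) = insertBlock (gsfsShuf cd₀ cd g α) m (cd i γ) i := by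
  induction γ using List.reverseRecOn with
  | nil =>
    have hα : α.Nodup := (List.nodup_append.1 hn).1
    have hp := gsfsShuf_perm (g := g) hcd₀ hcd hα
    have hi : i ∉ gsfsShuf cd₀ cd g α := fun h =>
      (notMem_of_nodup_append_cons hn).1 (hp.subset h)
    have hM : ∃ k, MarginalAt g (gsfsShuf cd₀ cd g α) i k :=
      ⟨k, (hg.marginalAt_iff hi k).2 ⟨hk, h1, by simpa using h0⟩⟩
    rcases gsfsShuf_append_singleton_cases hg hcd₀ hcd hn (gsfsShuf_hasShape hg hcd₀ hcd hα) with
      ⟨h, -, -⟩ | ⟨m, h, h'⟩ | ⟨h, -⟩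
    · have := hg.eq_one_of_subset (S := (α ++ [i]).toFinset) (fun y hy => by
        rw [Finset.mem_insert, List.mem_toFinset] at hy
        rcases hy with rfl | hy
        · simp
        · simp [hp.subset (List.mem_of_mem_take hy)]) h1
      rw [h] at this
      norm_num at this
    · exact ⟨m, h, by rw [h', (hcd i).nil]⟩
    · exact absurd hM h
  | append_singleton γ y ih =>
    have hnc : ((α ++ i :: γ) ++ [y]).Nodup := by simpa using hn
    have hn' : (α ++ i :: γ).Nodup := (List.nodup_append.1 hnc).1
    have hp := gsfsShuf_perm (g := g) hcd₀ hcd (List.nodup_append.1 hn').1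
    have hiγ := notMem_of_nodup_append_cons hn'
    have hb := (hcd i).perm_of_notMem (hn'.sublist (by simp) : γ.Nodup) hiγ.2
    obtain ⟨m, hm, hs⟩ := ih hn' (hg.eq_zero_of_subset (by intro z; simp; tauto) h0)
    have hmk : m ≤ k := by
      by_contra hlt
      have := hm.eq_zero_of_lt k (by omega)
      linarith
    rcases gsfsShuf_append_singleton_cases hg hcd₀ hcd hnc (gsfsShuf_hasShape hg hcd₀ hcd hn') with
      ⟨h, -, -⟩ | ⟨m', h, -⟩ | ⟨-, ρ, j, l, k', he, hpiv, hs', hs''⟩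
    · have := hg.eq_one_of_subset (S := (α ++ i :: γ ++ [y]).toFinset) (fun z hz => by
        rw [Finset.mem_insert, List.mem_toFinset] at hz
        rcases hz with rfl | hz
        · simp
        · simp [hp.subset (List.mem_of_mem_take hz)]) h1
      rw [h] at this
      norm_num at this
    · exfalso
      have hz : g ((gsfsShuf cd₀ cd g (α ++ i :: γ)).take m').toFinset = 0 := by
        simpa using h.eq_zero
      have ho := h.eq_one
      rw [hs, insertBlock] at hz ho
      set τ := gsfsShuf cd₀ cd g α
      -- The newcomer `y` is inserted no later than immediately before `i`, since a prefix that
      -- includes `i` already has value 1.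
      have hle : m' ≤ (τ.take m ++ cd i γ).length := by
        by_contra hlt
        obtain ⟨d, hd⟩ := Nat.exists_eq_add_of_lt (not_le.1 hlt)
        have := hg.eq_one_of_subset
          (S := ((τ.take m ++ cd i γ ++ i :: τ.drop m).take m').toFinset) (fun z hz => by
            rw [hd, Nat.add_assoc, List.take_length_add_append, List.take_succ_cons]
            simp only [Finset.mem_insert, List.mem_toFinset] at hz
            simp only [List.mem_toFinset, List.mem_append, List.mem_cons] at hz ⊢
            tauto) (hm.eq_one_append hg (cd i γ))
        linarith
      rw [List.take_append_of_le_length hle] at ho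
      -- By `m ≤ k`, the players before `y` together with `y` lie in the coalition of `h0`.
      have := hg.eq_one_of_subset (S := (τ.take k ++ (γ ++ [y])).toFinset) (fun z hz => by
        rw [Finset.mem_insert, List.mem_toFinset] at hz
        rcases hz with rfl | hz
        · simp
        · rcases List.mem_append.1 (List.mem_of_mem_take hz) with hz | hz
          · simp [List.take_subset_take_left _ hmk hz]
          · simp [hb.subset hz]) ho
      linarith
    · have hjl := notMem_of_nodup_append_cons (he ▸ hn')
      have hbj := (hcd j).perm_of_notMem ((he ▸ hn').sublist (by simp) : l.Nodup) hjl.2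
      obtain ⟨-, rfl, -⟩ := hg.marginal_split_unique (hs.symm.trans hs')
        (hm.eq_zero_of_perm hb) (hm.eq_one_append hg _)
        (hg.eq_zero_of_subset (fun z hz => by
          rcases List.mem_append.1 (List.mem_toFinset.1 hz) with hz | hz
          · simp [hz]
          · simp [hbj.subset hz]) hpiv.eq_zero) (hpiv.eq_one_append hg _)
      obtain ⟨rfl, -, rfl⟩ := (List.append_cons_inj_of_notMem hjl.1 hjl.2).1 he.symm
      exact ⟨k', hpiv, by simpa using hs''⟩

end SimpleGames

/-! ### Shares in simple games: monotonicity, bijectivity, locality -/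

section SimpleGameShares

variable {N : Type*} [Fintype N] [DecidableEq N] {cd₀ : List N → List N}
  {cd : N → List N → List N} {g : Finset N → ℝ}

/-- Player `i` is marginal in the final image order if and only if she could be made marginal on
arrival by an insertion that none of the later players invalidates. -/
theorem gsfsCS_eq_one_iff (hg : IsSimpleGame g)
    (hcd₀ : IsCoordinateFunction Finset.univ cd₀)
    (hcd : ∀ i : N, IsCoordinateFunction (Finset.univ.erase i) (cd i))
    {α γ : List N} {i : N} (hn : (α ++ i :: γ).Nodup) :
    gsfsCS cd₀ cd g (α ++ i :: γ) i = 1 ↔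
      ∃ k ≤ (gsfsShuf cd₀ cd g α).length,
        g (insert i ((gsfsShuf cd₀ cd g α).take k).toFinset) = 1 ∧
        g ((gsfsShuf cd₀ cd g α).take k ++ γ).toFinset = 0 := by
  constructor
  · intro h
    obtain ⟨k, hk⟩ := exists_isPivot_of_marginal hg hcd₀ hcd hn h
    exact ⟨k, hk.le_length, hk.eq_one, hk.eq_zero⟩
  · rintro ⟨k, hk, h1, h0⟩
    obtain ⟨m, hm, hs⟩ := gsfsShuf_eq_insertBlock hg hcd₀ hcd hn hk h1 h0
    have hp := gsfsShuf_perm (g := g) hcd₀ hcd hn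
    have hi := notMem_of_nodup_append_cons hn
    have hn' := hp.nodup_iff.2 hn
    rw [hs, insertBlock] at hn'
    rw [gsfsCS, hs, insertBlock, hg.MC_upTo_eq_one_iff (notMem_of_nodup_append_cons hn').1]
    exact ⟨hm.eq_one_append hg _,
      hm.eq_zero_of_perm ((hcd i).perm_of_notMem (hn.sublist (by simp)) hi.2)⟩

/-- The share of a player does not increase as further players arrive. -/
theorem gsfsCS_append_le (hg : IsSimpleGame g)
    (hcd₀ : IsCoordinateFunction Finset.univ cd₀)
    (hcd : ∀ i : N, IsCoordinateFunction (Finset.univ.erase i) (cd i))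
    {π l : List N} {i : N} (hn : (π ++ l).Nodup) (hi : i ∈ π) :
    gsfsCS cd₀ cd g (π ++ l) i ≤ gsfsCS cd₀ cd g π i := by
  obtain ⟨α, γ, rfl⟩ := List.append_of_mem hi
  refine hg.gsfsCS_le_of_imp fun h => ?_
  have hn' : (α ++ i :: (γ ++ l)).Nodup := by simpa using hn
  rw [List.append_assoc, List.cons_append, gsfsCS_eq_one_iff hg hcd₀ hcd hn'] at h
  obtain ⟨k, hk, h1, h0⟩ := h
  rw [gsfsCS_eq_one_iff hg hcd₀ hcd (List.nodup_append.1 hn).1]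
  exact ⟨k, hk, h1, hg.eq_zero_of_subset (by intro z; simp; tauto) h0⟩

/-- The share of a player does not decrease when she arrives later. -/
theorem gsfsCS_le_of_later (hg : IsSimpleGame g)
    (hcd₀ : IsCoordinateFunction Finset.univ cd₀)
    (hcd : ∀ i : N, IsCoordinateFunction (Finset.univ.erase i) (cd i))
    {α β γ : List N} {i : N} (hn : (α ++ i :: (β ++ γ)).Nodup) :
    gsfsCS cd₀ cd g (α ++ i :: (β ++ γ)) i ≤ gsfsCS cd₀ cd g (α ++ β ++ i :: γ) i := by
  refine hg.gsfsCS_le_of_imp fun h => ?_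
  have hn' : (α ++ β ++ i :: γ).Nodup := by
    rw [List.nodup_middle] at hn ⊢
    simpa using hn
  have hαβ : (α ++ β).Nodup := (List.nodup_append.1 hn').1
  rw [gsfsCS_eq_one_iff hg hcd₀ hcd hn] at h
  obtain ⟨k, hk, h1, h0⟩ := h
  rw [gsfsCS_eq_one_iff hg hcd₀ hcd hn']
  have hp := gsfsShuf_perm (g := g) hcd₀ hcd hαβ
  have hr := restrictOrder_gsfsShuf_append hg hcd₀ hcd hαβ
  rw [restrictOrder, ← List.take_append_drop k (gsfsShuf cd₀ cd g α),
    List.filter_eq_append_iff] at hr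
  -- `l₁` is a prefix of the image of `α ++ β` whose members from `α` are exactly the old prefix.
  -- Its other members lie in `β`, whose players arrive after `i` in the first order and are
  -- therefore already covered by `h0`.
  obtain ⟨l₁, l₂, hl, h₁, -⟩ := hr
  rw [hl] at hp ⊢
  refine ⟨l₁.length, by simp, ?_, ?_⟩
  · rw [List.take_left]
    refine hg.eq_one_of_subset (Finset.insert_subset_insert _ fun z hz => ?_) h1
    rw [← h₁, List.mem_toFinset] at hz
    exact List.mem_toFinset.2 (List.mem_of_mem_filter hz)
  · rw [List.take_left]
    refine hg.eq_zero_of_subset (fun z hz => ?_) h0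
    rw [List.mem_toFinset, List.mem_append] at hz
    rw [List.mem_toFinset, List.mem_append, List.mem_append]
    rcases hz with hz | hz
    · rcases List.mem_append.1 (hp.subset (List.mem_append_left l₂ hz)) with hα | hβ
      · left
        rw [← h₁]
        exact List.mem_filter.2 ⟨hz, by simpa⟩
      · exact .inr (.inl hβ)
    · exact .inr (.inr hz)

/-- The arrival order is decoded by strong induction on its length. The value of the full player set
tells which form the image has; in the pivot form the marginal split yields `j`, the position, the
image of the shorter order `ρ`, and `cd j l`. -/
theorem gsfsShuf_inj (hg : IsSimpleGame g)
    (hcd₀ : IsCoordinateFunction Finset.univ cd₀)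
    (hcd : ∀ i : N, IsCoordinateFunction (Finset.univ.erase i) (cd i))
    {π π' : List N} (hn : π.Nodup) (hn' : π'.Nodup)
    (h : gsfsShuf cd₀ cd g π = gsfsShuf cd₀ cd g π') : π = π' := by
  induction hl : π.length using Nat.strong_induction_on generalizing π π' with
  | _ n ih =>
  have hp := gsfsShuf_perm (g := g) hcd₀ hcd hn
  have hp' := gsfsShuf_perm (g := g) hcd₀ hcd hn'
  have hperm : π'.Perm π := hp'.symm.trans (h ▸ hp)
  have hset := List.toFinset_eq_of_perm _ _ hperm
  -- A pivot forces a nonzero total value, so the two forms of the image cannot occur for the same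
  -- player set.
  have hne : ∀ {ρ l : List N} {j : N} {k : ℕ}, ρ.Nodup →
      IsPivot g (gsfsShuf cd₀ cd g ρ) j l k → g (ρ ++ j :: l).toFinset ≠ 0 := by
    intro ρ l j k hρ hpiv h0
    have hρp := gsfsShuf_perm (g := g) hcd₀ hcd hρ
    have := hg.eq_one_of_subset (S := (ρ ++ j :: l).toFinset) (fun z hz => by
      rw [Finset.mem_insert, List.mem_toFinset] at hz
      rcases hz with rfl | hz
      · simp
      · simp [hρp.subset (List.mem_of_mem_take hz)]) hpiv.eq_one
    linarith
  rcases gsfsShuf_hasShape hg hcd₀ hcd hn with ⟨h0, hs⟩ | ⟨ρ, j, l, k, rfl, hpiv, hs⟩ <;>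
    rcases gsfsShuf_hasShape hg hcd₀ hcd hn' with ⟨h0', hs'⟩ | ⟨ρ', j', l', k', rfl, hpiv', hs'⟩
  · exact hcd₀.inj hn hperm (Finset.subset_univ _) (by rw [← hs, ← hs', h])
  · exact absurd (hset ▸ h0) (hne (hn'.sublist (by simp)) hpiv')
  · exact absurd (hset ▸ h0') (hne (hn.sublist (by simp)) hpiv)
  · have hj := notMem_of_nodup_append_cons hn
    have hj' := notMem_of_nodup_append_cons hn'
    have hρ : ρ.Nodup := hn.sublist (by simp)
    have hρ' : ρ'.Nodup := hn'.sublist (by simp)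
    have hlt : ρ.length < n := by rw [← hl]; simp
    have hln : l.Nodup := hn.sublist (by simp)
    have hln' : l'.Nodup := hn'.sublist (by simp)
    have hb := (hcd j).perm_of_notMem hln hj.2
    have hb' := (hcd j').perm_of_notMem hln' hj'.2
    rw [hs, hs'] at h
    obtain ⟨hA, rfl, hB⟩ := hg.marginal_split_unique h (hpiv.eq_zero_of_perm hb)
      (hpiv.eq_one_append hg _) (hpiv'.eq_zero_of_perm hb') (hpiv'.eq_one_append hg _)
    obtain rfl := hpiv.position_unique hpiv' hA
    obtain ⟨ht, hc⟩ := List.append_inj hA (by simp [hpiv.le_length, hpiv'.le_length])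
    have hτ : gsfsShuf cd₀ cd g ρ = gsfsShuf cd₀ cd g ρ' := by
      rw [← List.take_append_drop k (gsfsShuf cd₀ cd g ρ), ht, hB, List.take_append_drop]
    obtain rfl := ih _ hlt hρ hρ' hτ rfl
    obtain rfl := (hcd j).inj hln (hb'.symm.trans (hc ▸ hb)) (fun z hz => by
      simpa using fun h : z = j => hj.2 (h ▸ List.mem_toFinset.1 hz)) hc
    rfl

/-- The shuffle permutes the arrival orders. -/
theorem sum_orderings_gsfsShuf (hg : IsSimpleGame g)
    (hcd₀ : IsCoordinateFunction Finset.univ cd₀)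
    (hcd : ∀ i : N, IsCoordinateFunction (Finset.univ.erase i) (cd i))
    (S : Finset N) (F : List N → ℝ) :
    ∑ π ∈ orderings S, F (gsfsShuf cd₀ cd g π) = ∑ π ∈ orderings S, F π := by
  have hmap : ∀ π ∈ orderings S, gsfsShuf cd₀ cd g π ∈ orderings S := fun π hπ => by
    rw [mem_orderings] at hπ
    rw [← hπ.2, mem_orderings_iff_perm hπ.1]
    exact gsfsShuf_perm hcd₀ hcd hπ.1
  have hinj : Set.InjOn (gsfsShuf cd₀ cd g) (orderings S : Set (List N)) :=
    fun π hπ π' hπ' h => gsfsShuf_inj hg hcd₀ hcd ((mem_orderings S π).1 hπ).1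
      ((mem_orderings S π').1 hπ').1 h
  exact Finset.sum_nbij _ hmap hinj (Finset.surjOn_of_injOn_of_card_le _ hmap hinj le_rfl)
    fun _ _ => rfl

/-- The shuffle, and the shares, depend on the costs of coalitions of arrived players only. -/
theorem gsfsShuf_congr (hcd₀ : IsCoordinateFunction Finset.univ cd₀)
    (hcd : ∀ i : N, IsCoordinateFunction (Finset.univ.erase i) (cd i))
    {g' : Finset N → ℝ} {π : List N} (hn : π.Nodup) (h : ∀ T ⊆ π.toFinset, g T = g' T) :
    gsfsShuf cd₀ cd g π = gsfsShuf cd₀ cd g' π := by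
  induction π using List.reverseRecOn with
  | nil => rfl
  | append_singleton π x ih =>
    have hp := gsfsShuf_perm (g := g) hcd₀ hcd (List.nodup_append.1 hn).1
    rw [gsfsShuf_append_singleton, gsfsShuf_append_singleton,
      ← ih (List.nodup_append.1 hn).1 fun T hT => h T (hT.trans (by intro z; simp; tauto))]
    set img := gsfsShuf cd₀ cd g π
    have hM : ∀ k, MarginalAt g img x k ↔ MarginalAt g' img x k := fun k => by
      have hsub : insert x (img.take k).toFinset ⊆ (π ++ [x]).toFinset := fun z hz => by
        rw [Finset.mem_insert, List.mem_toFinset] at hz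
        rcases hz with rfl | hz
        · simp
        · simp [hp.subset (List.mem_of_mem_take hz)]
      rw [MarginalAt, MarginalAt, MC, MC, h _ hsub, h _ ((Finset.erase_subset _ _).trans hsub)]
    have hm : marginalPlayer g img = marginalPlayer g' img := by
      refine List.find?_congr fun j hj => ?_
      have hsub : upTo j img ⊆ (π ++ [x]).toFinset := fun z hz => by
        simp [hp.subset (List.mem_toFinset.1 (upTo_subset hj hz))]
      rw [MC, MC, h _ hsub, h _ ((Finset.erase_subset _ _).trans hsub)]
    have hM' : MarginalAt g img x = MarginalAt g' img x := funext fun k => propext (hM k)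
    rw [gsfsStep, gsfsStep, hm]
    -- `Nat.find` depends on the proof in the `if`, so the whole predicate is abstracted and
    -- substituted instead of being rewritten in place.
    generalize MarginalAt g img x = P at hM'
    subst hM'
    rfl

theorem gsfsCS_congr (hcd₀ : IsCoordinateFunction Finset.univ cd₀)
    (hcd : ∀ i : N, IsCoordinateFunction (Finset.univ.erase i) (cd i))
    {g' : Finset N → ℝ} {π : List N} (hn : π.Nodup) (h : ∀ T ⊆ π.toFinset, g T = g' T)
    {i : N} (hi : i ∈ π) : gsfsCS cd₀ cd g π i = gsfsCS cd₀ cd g' π i := by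
  have hp := gsfsShuf_perm (g := g') hcd₀ hcd hn
  have hsub := upTo_subset (hp.symm.subset hi)
  rw [List.toFinset_eq_of_perm _ _ hp] at hsub
  rw [gsfsCS, gsfsCS, gsfsShuf_congr hcd₀ hcd hn h, MC, MC, h _ hsub,
    h _ ((Finset.erase_subset _ _).trans hsub)]

/-- The image is an order of the same players, so the telescoping sum applies to it. -/
theorem sum_gsfsCS (hcd₀ : IsCoordinateFunction Finset.univ cd₀)
    (hcd : ∀ i : N, IsCoordinateFunction (Finset.univ.erase i) (cd i))
    (hg : Normalized g) {π : List N} (hn : π.Nodup) :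
    ∑ i ∈ π.toFinset, gsfsCS cd₀ cd g π i = g π.toFinset := by
  have hp := gsfsShuf_perm (g := g) hcd₀ hcd hn
  have := sum_MC_upTo g (hp.nodup_iff.2 hn)
  rwa [List.toFinset_eq_of_perm _ _ hp, hg, sub_zero] at this

end SimpleGameShares

/-! ### The greedy-monotone decomposition and level games -/

section Decomposition

variable {N : Type*} {c : Finset N → ℝ}

theorem MonotoneCost.nonneg (hmono : MonotoneCost c) (hnorm : Normalized c) (T : Finset N) :
    0 ≤ c T := hnorm ▸ hmono ∅ T T.empty_subset

open scoped Classical in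
/-- The 0-1 function indicating the coalitions whose cost exceeds `t`. -/
noncomputable def levelGame (c : Finset N → ℝ) (t : ℝ) : Finset N → ℝ :=
  fun T => if t < c T then 1 else 0

theorem levelGame_isSimpleGame (hnorm : Normalized c) (hmono : MonotoneCost c) {t : ℝ}
    (ht : 0 ≤ t) : IsSimpleGame (levelGame c t) where
  zero_or_one T := by
    unfold levelGame
    split_ifs <;> simp
  normalized := by
    rw [Normalized, levelGame, hnorm, if_neg (not_lt.2 ht)]
  mono T S h := by
    unfold levelGame
    have := hmono T S h
    split_ifs with h1 h2
    · exact le_rfl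
    · exact absurd (h1.trans_le this) h2
    · exact zero_le_one
    · exact le_rfl

variable [Fintype N]

theorem gmWeight_pos (h : (posSupport c).Nonempty) : 0 < gmWeight c h := by
  rw [gmWeight, Finset.lt_inf'_iff]
  intro T hT
  simpa [posSupport] using hT

theorem gmWeight_le (h : (posSupport c).Nonempty) {T : Finset N} (hT : 0 < c T) :
    gmWeight c h ≤ c T :=
  Finset.inf'_le _ (by simpa [posSupport] using hT)

theorem gmResidual_of_pos (h : (posSupport c).Nonempty) {T : Finset N} (hT : 0 < c T) :
    gmResidual c h T = c T - gmWeight c h := by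
  simp [gmResidual, gmIndicator, hT]

theorem gmResidual_of_not_pos (h : (posSupport c).Nonempty) {T : Finset N} (hT : ¬ 0 < c T) :
    gmResidual c h T = c T := by
  simp [gmResidual, gmIndicator, hT]

theorem gmResidual_normalized (hnorm : Normalized c) (h : (posSupport c).Nonempty) :
    Normalized (gmResidual c h) := by
  rw [Normalized, gmResidual_of_not_pos h (by rw [hnorm]; exact lt_irrefl 0), hnorm]

/-- The critical case is a nonpositive `c T` below a positive `c S`: the weight is the least
positive value, so what remains of `c S` is still nonnegative. -/
theorem gmResidual_mono (hmono : MonotoneCost c) (h : (posSupport c).Nonempty) :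
    MonotoneCost (gmResidual c h) := by
  intro T S hTS
  have hle := hmono T S hTS
  by_cases hT : 0 < c T
  · rw [gmResidual_of_pos h hT, gmResidual_of_pos h (hT.trans_le hle)]
    linarith
  · rw [gmResidual_of_not_pos h hT]
    by_cases hS : 0 < c S
    · rw [gmResidual_of_pos h hS]
      linarith [gmWeight_le h hS]
    · rwa [gmResidual_of_not_pos h hS]

theorem gmDecomposition_of_nonempty (h : (posSupport c).Nonempty) :
    gmDecomposition c = (gmIndicator c, gmWeight c h) :: gmDecomposition (gmResidual c h) := by
  rw [gmDecomposition, dif_pos h]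

theorem gmDecomposition_of_empty (h : ¬ (posSupport c).Nonempty) : gmDecomposition c = [] := by
  rw [gmDecomposition, dif_neg h]

theorem nonpos_of_posSupport_empty (h : ¬ (posSupport c).Nonempty) (T : Finset N) : c T ≤ 0 := by
  by_contra hT
  exact h ⟨T, by simpa [posSupport] using hT⟩

/-- Induction along the greedy-monotone decomposition. -/
theorem greedy_induction {P : ∀ c : Finset N → ℝ, Normalized c → MonotoneCost c → Prop}
    (empty : ∀ c hnorm hmono, ¬ (posSupport c).Nonempty → P c hnorm hmono)
    (step : ∀ c hnorm hmono, ∀ h : (posSupport c).Nonempty,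
      P (gmResidual c h) (gmResidual_normalized hnorm h) (gmResidual_mono hmono h) →
      P c hnorm hmono)
    (c : Finset N → ℝ) (hnorm : Normalized c) (hmono : MonotoneCost c) : P c hnorm hmono := by
  induction hk : (posSupport c).card using Nat.strong_induction_on generalizing c with
  | _ k ih =>
    by_cases h : (posSupport c).Nonempty
    · exact step c hnorm hmono h (ih _ (hk ▸ card_posSupport_gmResidual_lt c h) _
        (gmResidual_normalized hnorm h) (gmResidual_mono hmono h) rfl)
    · exact empty c hnorm hmono h

theorem gmDecomposition_isSimpleGame (hnorm : Normalized c) (hmono : MonotoneCost c) :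
    ∀ d ∈ gmDecomposition c, IsSimpleGame d.1 ∧ 0 ≤ d.2 := by
  induction c, hnorm, hmono using greedy_induction with
  | empty c hnorm hmono h => simp [gmDecomposition_of_empty h]
  | step c hnorm hmono h ih =>
    intro d hd
    rw [gmDecomposition_of_nonempty h, List.mem_cons] at hd
    rcases hd with rfl | hd
    · exact ⟨levelGame_isSimpleGame hnorm hmono le_rfl, (gmWeight_pos h).le⟩
    · exact ih d hd

theorem sum_gmDecomposition (hnorm : Normalized c) (hmono : MonotoneCost c) (T : Finset N) :
    c T = ((gmDecomposition c).map (fun d => d.2 * d.1 T)).sum := by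
  induction c, hnorm, hmono using greedy_induction with
  | empty c hnorm hmono h =>
    rw [gmDecomposition_of_empty h]
    exact le_antisymm (nonpos_of_posSupport_empty h T) (hmono.nonneg hnorm T)
  | step c hnorm hmono h ih =>
    rw [gmDecomposition_of_nonempty h, List.map_cons, List.sum_cons, ← ih, gmResidual]
    ring

theorem gmDecomposition_isZeroOneDecomposition (hnorm : Normalized c) (hmono : MonotoneCost c) :
    IsZeroOneDecomposition c (gmDecomposition c) := by
  refine ⟨fun d hd => ?_, sum_gmDecomposition hnorm hmono⟩
  obtain ⟨h, h'⟩ := gmDecomposition_isSimpleGame hnorm hmono d hd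
  exact ⟨h.zero_or_one, h.normalized, h.mono, h'⟩

/-- Above the first weight, a greedy step only shifts the level. Coalitions without positive cost
are unshifted, but they lie below both thresholds. -/
theorem levelGame_gmResidual (h : (posSupport c).Nonempty) {t : ℝ} (ht : gmWeight c h < t) :
    levelGame (gmResidual c h) (t - gmWeight c h) = levelGame c t := by
  funext T
  have hw := gmWeight_pos h
  unfold levelGame
  congr 1
  by_cases hT : 0 < c T
  · rw [gmResidual_of_pos h hT, sub_lt_sub_iff_right]
  · rw [gmResidual_of_not_pos h hT]
    exact propext ⟨fun h' => by linarith, fun h' => by linarith⟩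

theorem levelGame_of_le_gmWeight (h : (posSupport c).Nonempty) {t : ℝ} (ht : 0 < t)
    (ht' : t < gmWeight c h) : levelGame c t = gmIndicator c := by
  funext T
  unfold levelGame gmIndicator
  congr 1
  exact propext ⟨fun h' => ht.trans h', fun h' => ht'.trans_le (gmWeight_le h h')⟩

open MeasureTheory in
/-- A weighted sum over the greedy-monotone decomposition is an integral over the level games. -/
theorem sum_gmDecomposition_eq_integral {F : (Finset N → ℝ) → ℝ} (hF : F 0 = 0)
    (hnorm : Normalized c) (hmono : MonotoneCost c) :
    IntegrableOn (fun t => F (levelGame c t)) (Set.Ioi 0) ∧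
    ∫ t in Set.Ioi (0 : ℝ), F (levelGame c t) =
      ((gmDecomposition c).map (fun d => d.2 * F d.1)).sum := by
  induction c, hnorm, hmono using greedy_induction with
  | empty c hnorm hmono h =>
    have h0 : Set.EqOn (fun t => F (levelGame c t)) (fun _ => 0) (Set.Ioi 0) := by
      intro t ht
      have : levelGame c t = 0 := by
        funext T
        exact if_neg (not_lt.2 ((nonpos_of_posSupport_empty h T).trans (le_of_lt ht)))
      simp only [this, hF]
    rw [gmDecomposition_of_empty h, setIntegral_congr_fun measurableSet_Ioi h0,
      integrableOn_congr_fun h0 measurableSet_Ioi]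
    simp
  | step c hnorm hmono h ih =>
    set w := gmWeight c h with hw
    have hw0 : 0 < w := gmWeight_pos h
    have h1 : Set.EqOn (fun t => F (levelGame c t)) (fun _ => F (gmIndicator c))
        (Set.Ioo 0 w) := fun t ht => by
      simp only [levelGame_of_le_gmWeight h ht.1 ht.2]
    have h2 : Set.EqOn (fun t => F (levelGame c t))
        (fun t => F (levelGame (gmResidual c h) (t - w))) (Set.Ioi w) := fun t ht => by
      simp only [hw, levelGame_gmResidual h ht]
    have hmp : MeasurePreserving (fun t : ℝ => t - w) volume volume :=
      measurePreserving_sub_right volume w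
    have hme : MeasurableEmbedding (fun t : ℝ => t - w) := measurableEmbedding_subRight w
    have hpre : (fun t : ℝ => t - w) ⁻¹' Set.Ioi 0 = Set.Ioi w := by
      ext t; simp
    -- At `t = w` the coalitions of least positive cost have already dropped out of the level game,
    -- so the integrand is constant only on the open interval; the endpoint is a null set.
    have hi1 : IntegrableOn (fun t => F (levelGame c t)) (Set.Ioc 0 w) := by
      rw [integrableOn_Ioc_iff_integrableOn_Ioo, integrableOn_congr_fun h1 measurableSet_Ioo]
      exact integrableOn_const (by simp)
    have hi2 : IntegrableOn (fun t => F (levelGame c t)) (Set.Ioi w) := by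
      rw [integrableOn_congr_fun h2 measurableSet_Ioi, ← hpre]
      exact (hmp.integrableOn_comp_preimage hme).2 ih.1
    rw [← Set.Ioc_union_Ioi_eq_Ioi hw0.le]
    refine ⟨hi1.union hi2, ?_⟩
    rw [setIntegral_union (Set.Ioc_disjoint_Ioi le_rfl) measurableSet_Ioi hi1 hi2,
      integral_Ioc_eq_integral_Ioo, setIntegral_congr_fun measurableSet_Ioo h1,
      setIntegral_congr_fun measurableSet_Ioi h2, ← hpre,
      hmp.setIntegral_preimage_emb hme (fun t => F (levelGame (gmResidual c h) t)), ih.2,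
      gmDecomposition_of_nonempty h]
    simp [← hw, hw0.le]

end Decomposition

theorem Finset.sum_list_map_sum {α β : Type*} (s : Finset α) (l : List β) (f : β → α → ℝ) :
    ∑ a ∈ s, (l.map (fun d => f d a)).sum = (l.map (fun d => ∑ a ∈ s, f d a)).sum := by
  induction l with
  | nil => simp
  | cons d l ih => simp [Finset.sum_add_distrib, ih]

theorem List.sum_map_sub {β : Type*} (l : List β) (f g : β → ℝ) :
    (l.map (fun d => f d - g d)).sum = (l.map f).sum - (l.map g).sum := by
  induction l with
  | nil => simp
  | cons d l ih =>
    simp only [List.map_cons, List.sum_cons, ih]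
    ring

/-! ### From level games to general cost functions -/

section Main

variable {N : Type*} [DecidableEq N]

theorem levelGame_restrictCost (c : Finset N → ℝ) (S : Finset N) (t : ℝ) :
    levelGame (restrictCost c S) t = restrictCost (levelGame c t) S := rfl

theorem Normalized.restrictCost {c : Finset N → ℝ} (h : Normalized c) (S : Finset N) :
    Normalized (restrictCost c S) := by
  rw [Normalized, _root_.restrictCost, Finset.empty_inter, h]

theorem MonotoneCost.restrictCost {c : Finset N → ℝ} (h : MonotoneCost c) (S : Finset N) :
    MonotoneCost (restrictCost c S) :=
  fun _ _ hT => h _ _ (Finset.inter_subset_inter_right hT)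

theorem restrictCost_of_subset (c : Finset N → ℝ) {S T : Finset N} (h : T ⊆ S) :
    restrictCost c S T = c T := by
  rw [restrictCost, Finset.inter_eq_left.2 h]

theorem PrefixSet.restrictOrder_eq_take {S : Finset N} {π : List N} (hn : π.Nodup)
    (h : PrefixSet S π) : restrictOrder π S = π.take S.card := by
  have := restrictOrder_append_of_disjoint (l := π.take S.card) (m := π.drop S.card)
    (by rwa [List.take_append_drop])
  rwa [List.take_append_drop, h] at this

theorem List.Nodup.length_lt_of_upTo_ssubset {i : N} {A B A' B' : List N}
    (hn : (A ++ i :: B).Nodup) (hn' : (A' ++ i :: B').Nodup)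
    (h : upTo i (A ++ i :: B) ⊂ upTo i (A' ++ i :: B')) : A.length < A'.length := by
  have hi := (notMem_of_nodup_append_cons hn).1
  have hi' := (notMem_of_nodup_append_cons hn').1
  rw [upTo_append_cons hi, upTo_append_cons hi'] at h
  have := Finset.card_lt_card h
  rw [Finset.card_insert_of_notMem (by simpa), Finset.card_insert_of_notMem (by simpa),
    List.toFinset_card_of_nodup (List.nodup_append.1 hn).1,
    List.toFinset_card_of_nodup (List.nodup_append.1 hn').1] at this
  omega

theorem restrictOrder_erase [Fintype N] {i : N} {A B : List N} (hn : (A ++ i :: B).Nodup) :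
    restrictOrder (A ++ i :: B) (Finset.univ.erase i) = A ++ B := by
  obtain ⟨hA, hB⟩ := notMem_of_nodup_append_cons hn
  rw [restrictOrder, List.filter_append, List.filter_cons_of_neg (by simp),
    ← List.filter_append, List.filter_eq_self]
  intro a ha
  have : a ≠ i := by
    rintro rfl
    exact (List.mem_append.1 ha).elim hA hB
  simpa

variable {cd₀ : List N → List N} {cd : N → List N → List N} {c : Finset N → ℝ}

theorem gsfsCS_zero (π : List N) (i : N) : gsfsCS cd₀ cd 0 π i = 0 := by
  simp [gsfsCS, MC]

variable [Fintype N]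

open MeasureTheory in
-- The level `t` is a common index for two decompositions whose components and weights need not
-- correspond.
theorem egsfsCS_le {c c' : Finset N → ℝ} (hnorm : Normalized c) (hmono : MonotoneCost c)
    (hnorm' : Normalized c') (hmono' : MonotoneCost c') {π π' : List N} {i : N}
    (h : ∀ t : ℝ, 0 < t →
      gsfsCS cd₀ cd (levelGame c t) π i ≤ gsfsCS cd₀ cd (levelGame c' t) π' i) :
    egsfsCS cd₀ cd c π i ≤ egsfsCS cd₀ cd c' π' i := by
  obtain ⟨h1, h2⟩ := sum_gmDecomposition_eq_integral (F := fun g => gsfsCS cd₀ cd g π i)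
    (gsfsCS_zero π i) hnorm hmono
  obtain ⟨h1', h2'⟩ := sum_gmDecomposition_eq_integral (F := fun g => gsfsCS cd₀ cd g π' i)
    (gsfsCS_zero π' i) hnorm' hmono'
  rw [egsfsCS, egsfsCS, ← h2, ← h2']
  exact setIntegral_mono_on h1 h1' measurableSet_Ioi fun t ht => h t ht

theorem egsfsCS_isCostSharing (hcd₀ : IsCoordinateFunction Finset.univ cd₀)
    (hcd : ∀ i : N, IsCoordinateFunction (Finset.univ.erase i) (cd i))
    (hnorm : Normalized c) (hmono : MonotoneCost c) : IsCostSharing (egsfsCS cd₀ cd) c := by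
  intro π hπ S hS
  have hn := ((mem_orderings _ π).1 hπ).1
  rw [hS.restrictOrder_eq_take hn]
  have hn' : (π.take S.card).Nodup := hn.sublist (List.take_sublist _ _)
  have hD := gmDecomposition_isSimpleGame (hnorm.restrictCost S) (hmono.restrictCost S)
  constructor
  · intro i _
    refine List.sum_nonneg fun a ha => ?_
    obtain ⟨d, hd, rfl⟩ := List.mem_map.1 ha
    obtain ⟨hg, hw⟩ := hD d hd
    refine mul_nonneg hw ?_
    rcases hg.MC_zero_or_one i (upTo i (gsfsShuf cd₀ cd d.1 (π.take S.card))) with h | h <;>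
      simp [gsfsCS, h]
  · simp only [egsfsCS]
    rw [Finset.sum_list_map_sum]
    conv_rhs => rw [← restrictCost_of_subset c (Finset.Subset.refl S),
      sum_gmDecomposition (hnorm.restrictCost S) (hmono.restrictCost S) S]
    refine congrArg List.sum (List.map_congr_left fun d hd => ?_)
    have := sum_gsfsCS (cd₀ := cd₀) (cd := cd) hcd₀ hcd (hD d hd).1.normalized hn'
    rw [hS] at this
    rw [← Finset.mul_sum, this]

/-- Marginal costs are linear in the cost function, so the claim reduces to reindexing the sum over
orders by the shuffle of each component. -/
theorem egsfsCS_shapleyFair (hcd₀ : IsCoordinateFunction Finset.univ cd₀)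
    (hcd : ∀ i : N, IsCoordinateFunction (Finset.univ.erase i) (cd i))
    (hnorm : Normalized c) (hmono : MonotoneCost c) : ShapleyFair (egsfsCS cd₀ cd) c := by
  intro i
  rw [SV]
  congr 1
  have hMC : ∀ S, MC i c S = ((gmDecomposition c).map (fun d => d.2 * MC i d.1 S)).sum := by
    intro S
    simp only [MC, mul_sub]
    rw [List.sum_map_sub, ← sum_gmDecomposition hnorm hmono, ← sum_gmDecomposition hnorm hmono]
  simp only [hMC, egsfsCS]
  rw [Finset.sum_list_map_sum, Finset.sum_list_map_sum]
  refine congrArg List.sum (List.map_congr_left fun d hd => ?_)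
  rw [← Finset.mul_sum, ← Finset.mul_sum]
  congr 1
  exact sum_orderings_gsfsShuf (gmDecomposition_isSimpleGame hnorm hmono d hd).1 hcd₀ hcd _
    (fun π => MC i d.1 (upTo i π))

theorem egsfsCS_OIR (hcd₀ : IsCoordinateFunction Finset.univ cd₀)
    (hcd : ∀ i : N, IsCoordinateFunction (Finset.univ.erase i) (cd i))
    (hnorm : Normalized c) (hmono : MonotoneCost c) : OIR (egsfsCS cd₀ cd) c := by
  intro π hπ T S hT hS hTS i hi
  have hn := ((mem_orderings _ π).1 hπ).1
  rw [hT.restrictOrder_eq_take hn, hS.restrictOrder_eq_take hn]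
  refine egsfsCS_le (hnorm.restrictCost S) (hmono.restrictCost S) (hnorm.restrictCost T)
    (hmono.restrictCost T) fun t ht => ?_
  have hnT : (π.take T.card).Nodup := hn.sublist (List.take_sublist _ _)
  have hnS : (π.take S.card).Nodup := hn.sublist (List.take_sublist _ _)
  have hiT : i ∈ π.take T.card := by
    rw [← List.mem_toFinset, hT]
    exact hi
  have hpre : π.take T.card <+: π.take S.card :=
    List.take_prefix_take_left (Finset.card_le_card hTS)
  -- At a fixed level, both restricted games agree with the level game of `c` on the coalitions of
  -- arrived players, so by locality a single simple game remains.
  rw [levelGame_restrictCost, levelGame_restrictCost,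
    gsfsCS_congr (g' := levelGame c t) hcd₀ hcd hnT
      (fun U hU => restrictCost_of_subset _ (hU.trans hT.subset)) hiT,
    gsfsCS_congr (g' := levelGame c t) hcd₀ hcd hnS
      (fun U hU => restrictCost_of_subset _ (hU.trans hS.subset)) (hpre.subset hiT)]
  obtain ⟨l, hl⟩ := hpre
  rw [← hl] at hnS ⊢
  exact gsfsCS_append_le (levelGame_isSimpleGame hnorm hmono ht.le) hcd₀ hcd hnS hiT

theorem egsfsCS_I4EA (hcd₀ : IsCoordinateFunction Finset.univ cd₀)
    (hcd : ∀ i : N, IsCoordinateFunction (Finset.univ.erase i) (cd i))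
    (hnorm : Normalized c) (hmono : MonotoneCost c) : I4EA (egsfsCS cd₀ cd) c := by
  intro i π₁ hπ₁ π₂ hπ₂ hr hlt
  obtain ⟨hn₁, hu₁⟩ := (mem_orderings _ π₁).1 hπ₁
  obtain ⟨hn₂, hu₂⟩ := (mem_orderings _ π₂).1 hπ₂
  obtain ⟨A, B, rfl⟩ := List.append_of_mem (List.mem_toFinset.1 (hu₁ ▸ Finset.mem_univ i))
  obtain ⟨A', B', rfl⟩ := List.append_of_mem (List.mem_toFinset.1 (hu₂ ▸ Finset.mem_univ i))
  have hlen := hn₁.length_lt_of_upTo_ssubset hn₂ hlt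
  rw [restrictOrder_erase hn₁, restrictOrder_erase hn₂] at hr
  refine egsfsCS_le hnorm hmono hnorm hmono fun t ht => ?_
  -- Here `l` lists the players whom `i` precedes in `π₁` and follows in `π₂`; the other alternative
  -- contradicts the lengths.
  rcases List.append_eq_append_iff.1 hr with ⟨l, rfl, rfl⟩ | ⟨l, rfl, -⟩
  · exact gsfsCS_le_of_later (levelGame_isSimpleGame hnorm hmono ht.le) hcd₀ hcd hn₁
  · simp at hlen

end Main

theorem mainTheorem4 {N : Type*} [Fintype N] [DecidableEq N]
    (cd₀ : List N → List N) (cd : N → List N → List N)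
    (hcd₀ : IsCoordinateFunction Finset.univ cd₀)
    (hcd : ∀ i : N, IsCoordinateFunction (Finset.univ.erase i) (cd i))
    (c : Finset N → ℝ) (hnorm : Normalized c) (hmono : MonotoneCost c) :
    IsZeroOneDecomposition c (gmDecomposition c) ∧
    IsCostSharing (egsfsCS cd₀ cd) c ∧
    ShapleyFair (egsfsCS cd₀ cd) c ∧
    OIR (egsfsCS cd₀ cd) c ∧
    I4EA (egsfsCS cd₀ cd) c :=
  ⟨gmDecomposition_isZeroOneDecomposition hnorm hmono,
    egsfsCS_isCostSharing hcd₀ hcd hnorm hmono, egsfsCS_shapleyFair hcd₀ hcd hnorm hmono,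
    egsfsCS_OIR hcd₀ hcd hnorm hmono, egsfsCS_I4EA hcd₀ hcd hnorm hmono⟩
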